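/- Let $\mathbb{T}=\mathbb{R}/\mathbb{Z}$. For a finite non-negative Borel measure $\mu$ on $\mathbb{T}$, its lower Hausdorff dimension is $$\dim_{\mathrm H}(\mu)=\inf\{\alpha : \text{there is a Borel set } F\subset\mathbb{T} \text{ with } \mu(F)\neq 0 \text{ and } \dim_{\mathrm H}F\le\alpha\}.$$ For an integer $q\ge 3$ and a real number $a\in[-1,1]$, let $$\mu_{a,q}=\prod_{k=0}^{\infty}\bigl(1+a\cos(2\pi q^k x)\bigr)$$ be the Riesz product on $\mathbb{T}$, that is, the weak limit, as $N\to\infty$, of the measures with densities $\prod_{k=0}^{N-1}(1+a\cos(2\pi q^k x))$ with respect to Lebesgue measure on $\mathbb{T}$. **Theorem.** For every integer $q\ge 3$ and every $a\in[-1,1]$, $$\dim_{\mathrm H}(\mu_{a,q})\ \ge\ 1-\frac{1}{q\log q}\sum_{j=1}^{q-2}\left(1-\frac{\cos\frac{(2j+1)\pi}{q}}{\cos\frac{\pi}{q}}\right)\log\left(1-\frac{\cos\frac{(2j+1)\pi}{q}}{\cos\frac{\pi}{q}}\right).$$ -/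

import Mathlib

open MeasureTheory Filter Topology
open scoped ENNReal NNReal

noncomputable section

/-- The lower Hausdorff dimension of a Borel measure `μ`: the infimum of all `α` for which some
Borel set `F` with `μ F ≠ 0` has Hausdorff dimension at most `α`. -/
def lowerHausdorffDim {X : Type*} [EMetricSpace X] [MeasurableSpace X] [BorelSpace X]
    (μ : Measure X) : ℝ≥0∞ :=
  sInf {α : ℝ≥0∞ | ∃ F : Set X, MeasurableSet F ∧ μ F ≠ 0 ∧ dimH F ≤ α}

namespace RieszProduct

/-- The function `x ↦ cos (2π m x)` on the circle `ℝ / ℤ`, as the real part of the character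
`x ↦ exp (2π i m x)`. -/
def cosChar (m : ℤ) (x : UnitAddCircle) : ℝ := (fourier m x : ℂ).re

theorem cosChar_coe (m : ℤ) (x : ℝ) :
    cosChar m (x : UnitAddCircle) = Real.cos (2 * Real.pi * m * x) := by
  have h : (fourier m (x : UnitAddCircle) : ℂ)
      = Complex.exp (((2 * Real.pi * m * x : ℝ) : ℂ) * Complex.I) := by
    rw [fourier_coe_apply]
    congr 1
    push_cast
    ring
  rw [cosChar, h, Complex.exp_ofReal_mul_I_re]

/-- The partial product `∏_{k < N} (1 + a cos (2π q^k x))`. -/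
def density (a : ℝ) (q N : ℕ) (x : UnitAddCircle) : ℝ :=
  ∏ k ∈ Finset.range N, (1 + a * cosChar ((q : ℤ) ^ k) x)

theorem density_coe (a : ℝ) (q N : ℕ) (x : ℝ) :
    density a q N (x : UnitAddCircle)
      = ∏ k ∈ Finset.range N, (1 + a * Real.cos (2 * Real.pi * (q : ℝ) ^ k * x)) := by
  simp [density, cosChar_coe]

theorem continuous_density (a : ℝ) (q N : ℕ) : Continuous (density a q N) := by
  unfold density cosChar
  fun_prop

/-- The measure whose density with respect to Lebesgue measure on `ℝ / ℤ` is the `N`-th partial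
product. For `a ∈ [-1, 1]` the density is non-negative, so that `ENNReal.ofReal` does not
change it. -/
def partialMeasure (a : ℝ) (q N : ℕ) : FiniteMeasure UnitAddCircle :=
  ⟨(volume : Measure UnitAddCircle).withDensity fun x => ENNReal.ofReal (density a q N x),
    isFiniteMeasure_withDensity_ofReal
      ((continuous_density a q N).integrable_of_hasCompactSupport
        (HasCompactSupport.of_compactSpace _)).2⟩

end RieszProduct

/-- The Riesz product `μ_{a,q} = ∏_{k ≥ 0} (1 + a cos (2π q^k x))`: the weak limit of the measures
given by the partial products. The limit exists whenever `a ∈ [-1, 1]` and `q ≥ 3`, see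
`RieszProduct.tendsto_partialMeasure`. -/
def rieszProduct (a : ℝ) (q : ℕ) : FiniteMeasure UnitAddCircle :=
  haveI : Nonempty (FiniteMeasure UnitAddCircle) := ⟨0⟩
  limUnder atTop (RieszProduct.partialMeasure a q)

namespace RieszProduct

theorem density_nonneg {a : ℝ} (ha : a ∈ Set.Icc (-1 : ℝ) 1) (q N : ℕ) (x : UnitAddCircle) :
    0 ≤ density a q N x := by
  refine Finset.prod_nonneg fun k _ => ?_
  have h1 : |cosChar ((q : ℤ) ^ k) x| ≤ 1 := by
    refine (Complex.abs_re_le_norm _).trans ?_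
    exact (((fourier ((q : ℤ) ^ k)).norm_coe_le_norm x)).trans (fourier_norm _).le
  have h2 : |a| ≤ 1 := abs_le.mpr ha
  have h3 : |a * cosChar ((q : ℤ) ^ k) x| ≤ 1 := by
    rw [abs_mul]
    exact mul_le_one₀ h2 (abs_nonneg _) h1
  linarith [(abs_le.mp h3).1]

/-- The integral of the character of frequency `n` against the `N`-th partial product. -/
def coeff (a : ℝ) (q N : ℕ) (n : ℤ) : ℂ :=
  ∫ x : UnitAddCircle, (fourier n x : ℂ) * (density a q N x : ℂ)

theorem integrable_aux (a : ℝ) (q N : ℕ) (n : ℤ) :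
    Integrable (fun x : UnitAddCircle => (fourier n x : ℂ) * (density a q N x : ℂ)) := by
  have h := continuous_density a q N
  exact Continuous.integrable_of_hasCompactSupport (by fun_prop)
    (HasCompactSupport.of_compactSpace _)

theorem coeff_zero {a : ℝ} {q : ℕ} {n : ℤ} (hn : n ≠ 0) : coeff a q 0 n = 0 := by
  simp only [coeff, density, Finset.range_zero, Finset.prod_empty, Complex.ofReal_one, mul_one]
  exact integral_eq_zero_of_add_right_eq_neg (fourier_add_half_inv_index hn one_pos)

theorem coeff_zero_zero (a : ℝ) (q : ℕ) : coeff a q 0 0 = 1 := by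
  have h : (volume : Measure UnitAddCircle).real Set.univ = 1 := by
    rw [Measure.real, UnitAddCircle.measure_univ, ENNReal.toReal_one]
  simp [coeff, density, h]

theorem coeff_succ (a : ℝ) (q N : ℕ) (n : ℤ) :
    coeff a q (N + 1) n = coeff a q N n
      + a / 2 * (coeff a q N (n + (q : ℤ) ^ N) + coeff a q N (n - (q : ℤ) ^ N)) := by
  unfold coeff
  rw [← integral_add (integrable_aux a q N _) (integrable_aux a q N _), ← integral_const_mul,
    ← integral_add (integrable_aux a q N _) (Integrable.const_mul
      (f := fun x : UnitAddCircle => (fourier (n + (q : ℤ) ^ N) x : ℂ) * (density a q N x : ℂ)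
        + (fourier (n - (q : ℤ) ^ N) x : ℂ) * (density a q N x : ℂ))
      ((integrable_aux a q N _).add (integrable_aux a q N _)) _)]
  congr 1
  ext x
  have h : ((cosChar ((q : ℤ) ^ N) x : ℝ) : ℂ)
      = (fourier ((q : ℤ) ^ N) x + fourier (-(q : ℤ) ^ N) x) / 2 := by
    rw [fourier_neg, cosChar, Complex.re_eq_add_conj]
  rw [sub_eq_add_neg, fourier_add, fourier_add]
  have hd : density a q (N + 1) x = density a q N x * (1 + a * cosChar ((q : ℤ) ^ N) x) := by
    simp [density, Finset.prod_range_succ]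
  rw [hd]
  push_cast
  rw [h]
  ring

theorem coeff_eq_zero (a : ℝ) {q : ℕ} (hq : 3 ≤ q) (N : ℕ) :
    ∀ n : ℤ, (q : ℤ) ^ N ≤ 2 * |n| → coeff a q N n = 0 := by
  induction N with
  | zero =>
    intro n hn
    refine coeff_zero ?_
    rintro rfl
    simp at hn
  | succ N ih =>
    intro n hn
    have h0 : (0 : ℤ) < (q : ℤ) ^ N := by positivity
    have h1 : 3 * (q : ℤ) ^ N ≤ 2 * |n| := by
      refine le_trans ?_ hn
      rw [pow_succ']
      have : (3 : ℤ) ≤ q := by exact_mod_cast hq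
      nlinarith
    rw [coeff_succ, ih, ih, ih]
    · simp
    all_goals grind

theorem coeff_stable (a : ℝ) {q : ℕ} (hq : 3 ≤ q) {N : ℕ} {n : ℤ}
    (hn : 2 * |n| ≤ (q : ℤ) ^ N) : coeff a q (N + 1) n = coeff a q N n := by
  rw [coeff_succ, coeff_eq_zero a hq N (n + (q : ℤ) ^ N), coeff_eq_zero a hq N (n - (q : ℤ) ^ N)]
  · simp
  all_goals grind

theorem coeff_zero_right (a : ℝ) {q : ℕ} (hq : 3 ≤ q) (N : ℕ) : coeff a q N 0 = 1 := by
  induction N with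
  | zero => exact coeff_zero_zero a q
  | succ N ih => rw [coeff_stable a hq (by simp), ih]

theorem coeff_tendsto (a : ℝ) {q : ℕ} (hq : 3 ≤ q) (n : ℤ) :
    ∃ c : ℂ, Tendsto (fun N => coeff a q N n) atTop (𝓝 c) := by
  obtain ⟨M, hM⟩ : ∃ M : ℕ, 2 * |n| ≤ (q : ℤ) ^ M := by
    obtain ⟨M, hM⟩ := pow_unbounded_of_one_lt (2 * |n|) (show (1 : ℤ) < q by omega)
    exact ⟨M, hM.le⟩
  refine ⟨coeff a q M n, tendsto_const_nhds.congr' ?_⟩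
  filter_upwards [eventually_ge_atTop M] with N hN
  induction N, hN using Nat.le_induction with
  | base => rfl
  | succ N hN ih =>
    rw [coeff_stable a hq, ih]
    exact hM.trans (pow_le_pow_right₀ (by omega) hN)

theorem integral_partialMeasure {a : ℝ} (ha : a ∈ Set.Icc (-1 : ℝ) 1) (q N : ℕ) (n : ℤ) :
    ∫ x, (fourier n x : ℂ) ∂(partialMeasure a q N : Measure UnitAddCircle) = coeff a q N n := by
  change ∫ x, (fourier n x : ℂ) ∂((volume : Measure UnitAddCircle).withDensity
    fun x => ENNReal.ofReal (density a q N x)) = _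
  rw [integral_withDensity_eq_integral_toReal_smul
    (continuous_density a q N).measurable.ennreal_ofReal (by simp)]
  unfold coeff
  congr 1
  ext x
  rw [ENNReal.toReal_ofReal (density_nonneg ha q N x), Complex.real_smul, mul_comm]

theorem mass_partialMeasure {a : ℝ} (ha : a ∈ Set.Icc (-1 : ℝ) 1) {q : ℕ} (hq : 3 ≤ q) (N : ℕ) :
    (partialMeasure a q N).mass = 1 := by
  have h := integral_partialMeasure ha q N 0
  rw [coeff_zero_right a hq] at h
  simp only [fourier_zero, integral_const, Complex.real_smul, mul_one] at h
  have h2 : (partialMeasure a q N : Measure UnitAddCircle).real Set.univ = 1 := by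
    exact_mod_cast h
  have h3 : ((partialMeasure a q N).mass : ℝ) = 1 := h2
  exact_mod_cast h3

/-- A finite measure on the circle is determined by its Fourier coefficients. -/
theorem ext_fourier {μ ν : FiniteMeasure UnitAddCircle}
    (h : ∀ n : ℤ, ∫ x, (fourier n x : ℂ) ∂(μ : Measure UnitAddCircle)
      = ∫ x, (fourier n x : ℂ) ∂(ν : Measure UnitAddCircle)) : μ = ν := by
  let e := BoundedContinuousFunction.mkOfCompact (α := UnitAddCircle) (β := ℂ)
  have hint : ∀ (ρ : FiniteMeasure UnitAddCircle) (f : C(UnitAddCircle, ℂ)),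
      Integrable f (ρ : Measure UnitAddCircle) := fun ρ f =>
    f.continuous.integrable_of_hasCompactSupport (HasCompactSupport.of_compactSpace _)
  have hcont : ∀ ρ : FiniteMeasure UnitAddCircle,
      Continuous fun f : C(UnitAddCircle, ℂ) => ∫ x, f x ∂(ρ : Measure UnitAddCircle) := by
    intro ρ
    have h1 := (ContinuousMap.toLp (E := ℂ) 1 (ρ : Measure UnitAddCircle) ℂ).continuous
    refine (continuous_integral.comp h1).congr fun f => ?_
    exact integral_congr_ae (ContinuousMap.coeFn_toLp (ρ : Measure UnitAddCircle) f)
  let S : Submodule ℂ C(UnitAddCircle, ℂ) :=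
    { carrier := {f | ∫ x, f x ∂(μ : Measure UnitAddCircle)
        = ∫ x, f x ∂(ν : Measure UnitAddCircle)}
      add_mem' := by
        intro f g hf hg
        simp only [Set.mem_ofPred_eq, ContinuousMap.add_apply] at hf hg ⊢
        rw [integral_add (hint μ f) (hint μ g), integral_add (hint ν f) (hint ν g), hf, hg]
      zero_mem' := by simp
      smul_mem' := by
        intro c f hf
        simp only [Set.mem_ofPred_eq, ContinuousMap.smul_apply] at hf ⊢
        rw [integral_smul, integral_smul, hf] }
  have hS : IsClosed (S : Set C(UnitAddCircle, ℂ)) := isClosed_eq (hcont μ) (hcont ν)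
  have htop : S = ⊤ := by
    rw [eq_top_iff, ← span_fourier_closure_eq_top (T := 1)]
    refine Submodule.topologicalClosure_minimal _ (Submodule.span_le.mpr ?_) hS
    rintro _ ⟨n, rfl⟩
    exact h n
  apply Subtype.ext
  have : IsFiniteMeasure (μ.1 : Measure UnitAddCircle) := μ.2
  have : IsFiniteMeasure (ν.1 : Measure UnitAddCircle) := ν.2
  refine ext_of_forall_integral_eq_of_IsFiniteMeasure fun f => ?_
  have hf : (⟨fun x => (f x : ℂ), by fun_prop⟩ : C(UnitAddCircle, ℂ)) ∈ S := by
    rw [htop]; trivial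
  have hf' : ∫ x, (f x : ℂ) ∂(μ : Measure UnitAddCircle)
      = ∫ x, (f x : ℂ) ∂(ν : Measure UnitAddCircle) := hf
  rw [integral_complex_ofReal, integral_complex_ofReal] at hf'
  exact_mod_cast hf'

/-- The partial products converge weakly to the Riesz product. -/
theorem tendsto_partialMeasure {a : ℝ} (ha : a ∈ Set.Icc (-1 : ℝ) 1) {q : ℕ} (hq : 3 ≤ q) :
    Tendsto (partialMeasure a q) atTop (𝓝 (rieszProduct a q)) := by
  have hK := isCompact_setOfPred_finiteMeasure_le_of_compactSpace UnitAddCircle 1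
  have hmem : ∀ N, partialMeasure a q N ∈ {μ : FiniteMeasure UnitAddCircle | μ.mass ≤ 1} :=
    fun N => (mass_partialMeasure ha hq N).le
  have hcl : ∀ μ, MapClusterPt μ atTop (partialMeasure a q) → ∀ n c,
      Tendsto (fun N => coeff a q N n) atTop (𝓝 c) →
        ∫ x, (fourier n x : ℂ) ∂(μ : Measure UnitAddCircle) = c := by
    intro μ hμ n c hc
    have hcont : ContinuousAt (fun ρ : FiniteMeasure UnitAddCircle =>
        ∫ x, (fourier n x : ℂ) ∂(ρ : Measure UnitAddCircle)) μ :=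
      (FiniteMeasure.tendsto_iff_forall_integral_rclike_tendsto ℂ).mp tendsto_id
        (BoundedContinuousFunction.mkOfCompact (fourier n))
    have h1 := hμ.tendsto_comp hcont.tendsto
    have h2 : ((fun ρ : FiniteMeasure UnitAddCircle =>
        ∫ x, (fourier n x : ℂ) ∂(ρ : Measure UnitAddCircle)) ∘ partialMeasure a q)
        = fun N => coeff a q N n := funext fun N => integral_partialMeasure ha q N n
    rw [h2] at h1
    have h3 : ClusterPt (∫ x, (fourier n x : ℂ) ∂(μ : Measure UnitAddCircle)) (𝓝 c) :=
      ClusterPt.mono h1 hc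
    exact eq_of_nhds_neBot h3
  obtain ⟨μ, -, hμ⟩ := hK.exists_mapClusterPt (f := atTop) (u := partialMeasure a q)
    (tendsto_principal.mpr (Eventually.of_forall hmem))
  have hlim : Tendsto (partialMeasure a q) atTop (𝓝 μ) := by
    refine hK.tendsto_nhds_of_unique_mapClusterPt (Eventually.of_forall hmem) ?_
    intro ν _ hν
    refine ext_fourier fun n => ?_
    obtain ⟨c, hc⟩ := coeff_tendsto a hq n
    rw [hcl ν hν n c hc, hcl μ hμ n c hc]
  exact tendsto_nhds_limUnder ⟨μ, hlim⟩

end RieszProduct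

end

/-!
For a small `t > 0` put `p = 1 + t`, let `P_n` be the partial products and `μ` the Riesz product.
The factor `1 + a cos (2πx)` is averaged over translations by `j / q`, under which `x ↦ q x` is
invariant; since `P_{n+1}(x) = (1 + a cos (2πx)) P_n(q x)`, this gives `∫ P_n ^ p ≤ κ ^ n` as soon
as the averages `(1/q) ∑_j (1 + a cos (2π(x + j/q))) ^ p` are at most `κ`.
Such an average is a convex function of the point `z = a exp (2πix)`, which lies in the unit disc
and hence in the regular `q`-gon `{z : 1 + Re (z ω) ≥ 0 for all q-th roots of unity ω}`. It is
therefore at most its value at a vertex, where the numbers `1 + Re (z ω)` are the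
`V_j = 1 - cos ((2j+1)π/q) / cos (π/q)` (`RieszProduct.sum_convex_rotation_le`). So
`κ = (1/q) ∑_j V_j ^ p` (`RieszProduct.growth`) is admissible.

The measures `μ` and `P_n dx` have the same Fourier coefficients up to frequency `q ^ n / 2`, so
convolution with a Fejér kernel of that order does not distinguish them. The kernel being large
near `0`, it bounds `μ(B(x, q⁻ⁿ))` by the convolution, and Young's inequality turns the bound for
`P_n` into one for the `L ^ p` norm of `x ↦ μ(B(x, q⁻ⁿ))`. A Fubini argument then gives
`∫ μ(B(x, q⁻ⁿ)) ^ t dμ(x) ≤ C (κ q^(-t)) ^ n`, and by Chebyshev's inequality and Borel-Cantelli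
almost every `x` satisfies `μ(B(x, q⁻ⁿ)) < q ^ (-ns)` for all large `n`, provided that
`κ < q ^ ((1-s)t)` (`RieszProduct.measure_heavySet_le`). By the mass distribution principle
(`le_dimH_of_measure_closedBall_le`) every set of positive measure then has dimension at least `s`.

Finally `κ = 1` at `t = 0`, and its derivative there is `(1/q) ∑_j V_j log V_j`, so a suitable `t`
exists for every `s < 1 - (1 / (q log q)) ∑_j V_j log V_j` (`RieszProduct.exists_growth_lt`). The
terms with `j = 0` and `j = q - 1` vanish.
-/

/-! ### Convex functions on a regular polygon -/

namespace RieszProduct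

/-- The values `1 - cos ((2j+1)π/q) / cos (π/q)`. For a vertex `z` of the regular `q`-gon
`{z : ∀ ω, ω ^ q = 1 → 0 ≤ 1 + Re (z ω)}` these are the numbers `1 + Re (z ω)`, where `ω` runs
through the `q`-th roots of unity. -/
noncomputable def vertexWeight (q j : ℕ) : ℝ :=
  1 - Real.cos ((2 * j + 1) * Real.pi / q) / Real.cos (Real.pi / q)

theorem cos_pi_div_pos {q : ℕ} (hq : 3 ≤ q) : 0 < Real.cos (Real.pi / q) := by
  have hq' : (3 : ℝ) ≤ q := by exact_mod_cast hq
  have hpi := Real.pi_pos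
  refine Real.cos_pos_of_mem_Ioo ⟨by have : 0 < Real.pi / q := by positivity
                                     linarith, ?_⟩
  rw [div_lt_div_iff₀ (by linarith) two_pos]
  nlinarith

theorem vertexWeight_zero {q : ℕ} (hq : 3 ≤ q) : vertexWeight q 0 = 0 := by
  have := (cos_pi_div_pos hq).ne'
  simp [vertexWeight, this]

theorem vertexWeight_add_self {q : ℕ} (hq : 3 ≤ q) (j : ℕ) :
    vertexWeight q (j + q) = vertexWeight q j := by
  have hq' : (q : ℝ) ≠ 0 := by positivity
  have : (2 * ((j + q : ℕ) : ℝ) + 1) * Real.pi / q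
      = (2 * j + 1) * Real.pi / q + 2 * Real.pi := by
    push_cast
    field_simp
    ring
  rw [vertexWeight, this, Real.cos_add_two_pi, vertexWeight]

theorem vertexWeight_pred_self {q : ℕ} (hq : 3 ≤ q) : vertexWeight q (q - 1) = 0 := by
  have hq' : (q : ℝ) ≠ 0 := by positivity
  have : (2 * ((q - 1 : ℕ) : ℝ) + 1) * Real.pi / q = 2 * Real.pi - Real.pi / q := by
    rw [Nat.cast_sub (by omega)]
    push_cast
    field_simp
    ring
  rw [vertexWeight, this, Real.cos_two_pi_sub, div_self (cos_pi_div_pos hq).ne', sub_self]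

theorem vertexWeight_nonneg_of_lt {q : ℕ} (hq : 3 ≤ q) {j : ℕ} (hj : j < q) :
    0 ≤ vertexWeight q j := by
  have hc := cos_pi_div_pos hq
  have hq' : (0 : ℝ) < q := by positivity
  have hpi := Real.pi_pos
  have hj' : (j : ℝ) + 1 ≤ q := by exact_mod_cast hj
  have h0 : (0 : ℝ) ≤ j := by positivity
  rw [vertexWeight, sub_nonneg, div_le_one hc]
  -- The angle lies in `[π/q, 2π - π/q]`, on which the cosine is at most `cos (π/q)`.
  have h1 : Real.pi / q ≤ (2 * j + 1) * Real.pi / q := by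
    gcongr
    nlinarith
  have h2 : (2 * j + 1) * Real.pi / q ≤ 2 * Real.pi - Real.pi / q := by
    rw [le_sub_iff_add_le, ← add_div, div_le_iff₀ hq']
    nlinarith
  rcases le_total ((2 * j + 1) * Real.pi / q) Real.pi with h | h
  · exact Real.cos_le_cos_of_nonneg_of_le_pi (by positivity) h h1
  · rw [← Real.cos_two_pi_sub ((2 * j + 1) * Real.pi / q)]
    exact Real.cos_le_cos_of_nonneg_of_le_pi (by positivity) (by linarith) (by linarith)

theorem vertexWeight_nonneg_of_le {q : ℕ} (hq : 3 ≤ q) {j : ℕ} (hj : j ≤ q) :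
    0 ≤ vertexWeight q j := by
  rcases hj.lt_or_eq with h | rfl
  · exact vertexWeight_nonneg_of_lt hq h
  · have := vertexWeight_add_self hq 0
    rw [zero_add] at this
    rw [this, vertexWeight_zero hq]

theorem sum_range_shift {M : Type*} [AddCommGroup M] (f : ℕ → M) {q : ℕ} (h : f q = f 0) :
    ∑ j ∈ Finset.range q, f (j + 1) = ∑ j ∈ Finset.range q, f j := by
  have h1 := Finset.sum_range_succ f q
  rw [Finset.sum_range_succ' f q, h] at h1
  exact add_right_cancel h1

/-- The sum of a `2π`-periodic function over a coset of the `q`-th roots of unity depends only on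
the coset. -/
theorem periodic_sum_rotation {g : ℝ → ℝ} (hg : Function.Periodic g (2 * Real.pi)) {q : ℕ}
    (hq : 0 < q) :
    Function.Periodic
      (fun θ => ∑ j ∈ Finset.range q, g (θ + (2 * j + 1) * Real.pi / q)) (2 * Real.pi / q) := by
  intro θ
  have hq' : (q : ℝ) ≠ 0 := by positivity
  have := sum_range_shift (fun j : ℕ => g (θ + (2 * j + 1) * Real.pi / q)) (q := q) (by
    rw [← hg (θ + (2 * ((0 : ℕ) : ℝ) + 1) * Real.pi / q)]
    congr 1
    push_cast
    field_simp
    ring)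
  simp only
  rw [← this]
  refine Finset.sum_congr rfl fun j _ => ?_
  congr 1
  push_cast
  field_simp
  ring

theorem sum_cos_rotation {q : ℕ} (hq : 2 ≤ q) (θ : ℝ) :
    ∑ j ∈ Finset.range q, Real.cos (θ + (2 * j + 1) * Real.pi / q) = 0 := by
  have hq' : (2 : ℝ) ≤ q := by exact_mod_cast hq
  have hpi := Real.pi_pos
  have hper := periodic_sum_rotation Real.cos_periodic (q := q) (by omega)
  set S : ℝ → ℝ := fun θ => ∑ j ∈ Finset.range q, Real.cos (θ + (2 * j + 1) * Real.pi / q)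
  set c := 2 * Real.pi / q
  -- `S` has period `c` and satisfies the addition formula of the cosine, and `cos c ≠ 1`.
  have h1 : S (θ + c) + S (θ - c) = 2 * Real.cos c * S θ := by
    simp only [S, Finset.mul_sum, ← Finset.sum_add_distrib]
    refine Finset.sum_congr rfl fun j _ => ?_
    rw [show θ + c + (2 * j + 1) * Real.pi / q = (θ + (2 * j + 1) * Real.pi / q) + c by ring,
      show θ - c + (2 * j + 1) * Real.pi / q = (θ + (2 * j + 1) * Real.pi / q) - c by ring,
      Real.cos_add, Real.cos_sub]
    ring
  rw [hper θ, hper.sub_eq θ] at h1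
  have hc0 : 0 < c := by positivity
  have hc1 : c ≤ Real.pi := by
    rw [div_le_iff₀ (by linarith)]
    nlinarith
  have hc : Real.cos c < 1 := by
    rw [← Real.cos_zero]
    exact Real.cos_lt_cos_of_nonneg_of_le_pi le_rfl hc1 hc0
  have h2 : (1 - Real.cos c) * S θ = 0 := by linarith
  exact (mul_eq_zero.mp h2).resolve_left (by linarith)

theorem sum_vertexWeight {q : ℕ} (hq : 3 ≤ q) :
    ∑ j ∈ Finset.range q, vertexWeight q j = q := by
  have h := sum_cos_rotation (q := q) (by omega) 0
  simp only [zero_add] at h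
  simp only [vertexWeight, Finset.sum_sub_distrib, ← Finset.sum_div, h]
  simp

/-- Jensen's inequality at the centre of the polygon. -/
theorem mul_apply_one_le_sum_vertexWeight {q : ℕ} (hq : 3 ≤ q) {φ : ℝ → ℝ}
    (hφ : ConvexOn ℝ (Set.Ici 0) φ) :
    q * φ 1 ≤ ∑ j ∈ Finset.range q, φ (vertexWeight q j) := by
  have hq' : (0 : ℝ) < q := by positivity
  have h := hφ.map_sum_le (t := Finset.range q) (w := fun _ => 1 / (q : ℝ))
    (p := vertexWeight q) (fun _ _ => by positivity) (by simp [hq'.ne'])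
    (fun j hj => vertexWeight_nonneg_of_lt hq (Finset.mem_range.mp hj))
  simp only [smul_eq_mul, ← Finset.mul_sum] at h
  rw [sum_vertexWeight hq, one_div_mul_cancel hq'.ne', one_div, ← div_eq_inv_mul,
    le_div_iff₀ hq', mul_comm] at h
  exact h

/-- For a convex function `φ`, the average of `φ (1 + Re (z ω))` over the roots of unity is a
convex function of `z`. Here `z` is taken in a triangle spanned by the centre of the polygon and
two neighbouring vertices, and at these three points the average is at most the one at a
vertex. -/
theorem sum_convex_sector_le {q : ℕ} (hq : 3 ≤ q) {φ : ℝ → ℝ} (hφ : ConvexOn ℝ (Set.Ici 0) φ)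
    {r δ : ℝ} (hr : r ∈ Set.Icc 0 1) (hδ : δ ∈ Set.Icc 0 (2 * Real.pi / q)) :
    ∑ j ∈ Finset.range q, φ (1 - r * Real.cos (δ + (2 * j + 1) * Real.pi / q))
      ≤ ∑ j ∈ Finset.range q, φ (vertexWeight q j) := by
  have hq' : (3 : ℝ) ≤ q := by exact_mod_cast hq
  have hpi := Real.pi_pos
  have hc := cos_pi_div_pos hq
  set h := Real.pi / q with hh
  have h0 : 0 < h := by positivity
  have h1 : 2 * h ≤ Real.pi := by
    rw [hh, mul_div_assoc', div_le_iff₀ (by linarith)]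
    nlinarith
  have h2 : 2 * Real.pi / q = 2 * h := by rw [hh]; ring
  rw [h2] at hδ
  have hs : 0 < Real.sin h := Real.sin_pos_of_pos_of_lt_pi h0 (by linarith)
  -- The barycentric coordinates with respect to the two vertices.
  set l := r * Real.sin (2 * h - δ) / (2 * Real.sin h) with hl
  set v := r * Real.sin δ / (2 * Real.sin h) with hv
  have hl0 : 0 ≤ l := div_nonneg (mul_nonneg hr.1
    (Real.sin_nonneg_of_nonneg_of_le_pi (by linarith [hδ.2]) (by linarith [hδ.1]))) (by positivity)
  have hv0 : 0 ≤ v := div_nonneg (mul_nonneg hr.1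
    (Real.sin_nonneg_of_nonneg_of_le_pi hδ.1 (by linarith [hδ.2]))) (by positivity)
  have hlv : l + v = r * Real.cos (h - δ) := by
    rw [hl, hv, ← add_div, div_eq_iff (by positivity), Real.sin_sub, Real.sin_two_mul,
      Real.cos_two_mul, Real.cos_sub]
    have := Real.sin_sq_add_cos_sq h
    linear_combination (-2 * r * Real.sin δ) * this
  have hlv1 : l + v ≤ 1 := by
    rw [hlv]
    nlinarith [Real.cos_le_one (h - δ), hr.1, hr.2]
  have hrep (j : ℕ) : 1 - r * Real.cos (δ + (2 * j + 1) * Real.pi / q)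
      = (1 - l - v) * 1 + l * vertexWeight q j + v * vertexWeight q (j + 1) := by
    have e : (2 * ((j + 1 : ℕ) : ℝ) + 1) * Real.pi / q = (2 * j + 1) * Real.pi / q + 2 * h := by
      rw [hh]
      push_cast
      ring
    rw [vertexWeight, vertexWeight, e, ← hh]
    set β := (2 * j + 1) * Real.pi / q
    have key : r * Real.cos (δ + β) * (2 * Real.sin h * Real.cos h)
        = r * Real.sin (2 * h - δ) * Real.cos β + r * Real.sin δ * Real.cos (β + 2 * h) := by
      rw [Real.cos_add, Real.cos_add, Real.sin_sub, Real.sin_two_mul]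
      ring
    have key' : r * Real.cos (δ + β)
        = (l * Real.cos β + v * Real.cos (β + 2 * h)) / Real.cos h := by
      rw [hl, hv, eq_div_iff hc.ne', div_mul_eq_mul_div, div_mul_eq_mul_div, ← add_div,
        eq_div_iff (by positivity), ← key]
      ring
    rw [key']
    ring
  have hconv (j : ℕ) (hj : j < q) : φ (1 - r * Real.cos (δ + (2 * j + 1) * Real.pi / q))
      ≤ (1 - l - v) * φ 1 + l * φ (vertexWeight q j) + v * φ (vertexWeight q (j + 1)) := by
    have hV := vertexWeight_nonneg_of_lt hq hj
    have hV' := vertexWeight_nonneg_of_le hq (Nat.succ_le_of_lt hj)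
    have := hφ.map_sum_le (t := Finset.univ) (w := ![1 - l - v, l, v])
      (p := ![1, vertexWeight q j, vertexWeight q (j + 1)])
      (by intro i _; fin_cases i <;> simp <;> linarith)
      (by simp only [Fin.sum_univ_three, Matrix.cons_val]; ring)
      (by intro i _; fin_cases i <;> simp [hV, hV'])
    simp only [Fin.sum_univ_three, Matrix.cons_val, smul_eq_mul] at this
    rw [hrep]
    exact this
  have hshift := sum_range_shift (fun j => φ (vertexWeight q j)) (q := q) (by
    have := vertexWeight_add_self hq 0
    rw [zero_add] at this
    rw [this])
  calc _ ≤ ∑ j ∈ Finset.range q,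
        ((1 - l - v) * φ 1 + l * φ (vertexWeight q j) + v * φ (vertexWeight q (j + 1))) :=
      Finset.sum_le_sum fun j hj => hconv j (Finset.mem_range.mp hj)
    _ = (1 - l - v) * (q * φ 1) + (l + v) * ∑ j ∈ Finset.range q, φ (vertexWeight q j) := by
      rw [Finset.sum_add_distrib, Finset.sum_add_distrib, ← Finset.mul_sum, ← Finset.mul_sum,
        ← Finset.mul_sum, hshift, Finset.sum_const, Finset.card_range, nsmul_eq_mul]
      ring
    _ ≤ _ := by
      have := mul_apply_one_le_sum_vertexWeight hq hφ
      nlinarith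

/-- The unit disc is contained in the polygon, so that a convex function of its points is
dominated by its value at the vertices. -/
theorem sum_convex_rotation_le {q : ℕ} (hq : 3 ≤ q) {φ : ℝ → ℝ}
    (hφ : ConvexOn ℝ (Set.Ici 0) φ) {a : ℝ} (ha : a ∈ Set.Icc (-1 : ℝ) 1) (θ : ℝ) :
    ∑ j ∈ Finset.range q, φ (1 + a * Real.cos (θ + 2 * Real.pi * j / q))
      ≤ ∑ j ∈ Finset.range q, φ (vertexWeight q j) := by
  have hq' : (0 : ℝ) < q := by positivity
  have hpi := Real.pi_pos
  have main (r θ' : ℝ) (hr : r ∈ Set.Icc (0 : ℝ) 1) :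
      ∑ j ∈ Finset.range q, φ (1 - r * Real.cos (θ' + (2 * j + 1) * Real.pi / q))
        ≤ ∑ j ∈ Finset.range q, φ (vertexWeight q j) := by
    have hper := periodic_sum_rotation (g := fun u => φ (1 - r * Real.cos u))
      (fun u => by simp only [Real.cos_add_two_pi]) (q := q) (by omega)
    obtain ⟨δ, hδ, h⟩ := hper.exists_mem_Ico₀ (by positivity) θ'
    rw [h]
    exact sum_convex_sector_le hq hφ hr ⟨hδ.1, hδ.2.le⟩
  rcases le_total a 0 with h | h
  · convert main (-a) (θ - Real.pi / q) ⟨by linarith, by linarith [ha.1]⟩ using 3 with j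
    rw [show θ - Real.pi / q + (2 * j + 1) * Real.pi / q = θ + 2 * Real.pi * j / q by ring]
    ring_nf
  · convert main a (θ - Real.pi / q + Real.pi) ⟨h, ha.2⟩ using 3 with j
    rw [show θ - Real.pi / q + Real.pi + (2 * j + 1) * Real.pi / q
      = θ + 2 * Real.pi * j / q + Real.pi by ring, Real.cos_add_pi]
    ring_nf

/-- The power means `(1/q) ∑ V_j ^ (1 + t)` of the vertex weights, written so that the
contribution of a vanishing weight is a constant. -/
noncomputable def growth (q : ℕ) (t : ℝ) : ℝ :=
  1 / q * ∑ j ∈ Finset.range q, vertexWeight q j * vertexWeight q j ^ t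

theorem growth_nonneg {q : ℕ} (hq : 3 ≤ q) (t : ℝ) : 0 ≤ growth q t := by
  refine mul_nonneg (by positivity) (Finset.sum_nonneg fun j hj => ?_)
  have := vertexWeight_nonneg_of_lt hq (Finset.mem_range.mp hj)
  positivity

theorem sum_rpow_rotation_le {q : ℕ} (hq : 3 ≤ q) {a : ℝ} (ha : a ∈ Set.Icc (-1 : ℝ) 1)
    {t : ℝ} (ht : 0 < t) (θ : ℝ) :
    ∑ j ∈ Finset.range q, (1 + a * Real.cos (θ + 2 * Real.pi * j / q)) ^ (1 + t)
      ≤ q * growth q t := by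
  refine (sum_convex_rotation_le hq (convexOn_rpow (by linarith)) ha θ).trans_eq ?_
  rw [growth, ← mul_assoc, mul_one_div_cancel (by positivity), one_mul]
  refine Finset.sum_congr rfl fun j hj => ?_
  rw [Real.rpow_add' (vertexWeight_nonneg_of_lt hq (Finset.mem_range.mp hj)) (by positivity),
    Real.rpow_one]

theorem hasDerivAt_growth {q : ℕ} (hq : 3 ≤ q) :
    HasDerivAt (growth q)
      (1 / q * ∑ j ∈ Finset.range q, vertexWeight q j * Real.log (vertexWeight q j)) 0 := by
  refine HasDerivAt.const_mul _ (HasDerivAt.fun_sum fun j hj => ?_)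
  rcases (vertexWeight_nonneg_of_lt hq (Finset.mem_range.mp hj)).eq_or_lt with h | h
  · simpa [← h] using hasDerivAt_const (0 : ℝ) (0 : ℝ)
  · simpa using ((hasDerivAt_id (0 : ℝ)).const_rpow h).const_mul (vertexWeight q j)

theorem growth_zero {q : ℕ} (hq : 3 ≤ q) : growth q 0 = 1 := by
  have hq' : (q : ℝ) ≠ 0 := by positivity
  simp [growth, sum_vertexWeight hq, hq']

theorem sum_vertexWeight_mul_log {q : ℕ} (hq : 3 ≤ q) :
    ∑ j ∈ Finset.range q, vertexWeight q j * Real.log (vertexWeight q j)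
      = ∑ j ∈ Finset.Icc 1 (q - 2), vertexWeight q j * Real.log (vertexWeight q j) := by
  symm
  refine Finset.sum_subset (fun j hj => ?_) fun j hj hj' => ?_
  · simp only [Finset.mem_Icc, Finset.mem_range] at *
    omega
  · simp only [Finset.mem_Icc, Finset.mem_range] at *
    obtain rfl | rfl : j = 0 ∨ j = q - 1 := by omega
    · simp [vertexWeight_zero hq]
    · simp [vertexWeight_pred_self hq]

/-- The entropy of the vertex weights is the derivative at `0` of the logarithm of the power
means; hence below the dimension bound `s` the exponential rates compare for small `t`. -/
theorem exists_growth_lt {q : ℕ} (hq : 3 ≤ q) {s : ℝ}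
    (hs : s < 1 - 1 / (q * Real.log q) *
      ∑ j ∈ Finset.Icc 1 (q - 2), vertexWeight q j * Real.log (vertexWeight q j)) :
    ∃ t : ℝ, 0 < t ∧ growth q t < (q : ℝ) ^ ((1 - s) * t) := by
  have hq0 : (0 : ℝ) < q := by positivity
  have hlog : 0 < Real.log q := Real.log_pos (by exact_mod_cast (by omega : 1 < q))
  have h1 : HasDerivAt (fun t : ℝ => (q : ℝ) ^ ((1 - s) * t)) (Real.log q * (1 - s)) 0 := by
    simpa using ((hasDerivAt_id (0 : ℝ)).const_mul (1 - s)).const_rpow hq0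
  have h2 := (hasDerivAt_growth hq).sub h1
  rw [sum_vertexWeight_mul_log hq] at h2
  set E := ∑ j ∈ Finset.Icc 1 (q - 2), vertexWeight q j * Real.log (vertexWeight q j)
  have hneg : 1 / q * E - Real.log q * (1 - s) < 0 := by
    have h3 : 1 / (q * Real.log q) * E < 1 - s := by linarith
    have h4 : Real.log q * (1 / (q * Real.log q) * E) < Real.log q * (1 - s) :=
      mul_lt_mul_of_pos_left h3 hlog
    have h5 : Real.log q * (1 / (q * Real.log q) * E) = 1 / q * E := by
      field_simp
    linarith
  have h3 := (hasDerivAt_iff_tendsto_slope_left_right.mp h2).2.eventually_lt_const hneg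
  obtain ⟨t, ht, ht'⟩ := (h3.and self_mem_nhdsWithin).exists
  refine ⟨t, ht', ?_⟩
  rw [slope_def_field] at ht
  simp only [Pi.sub_apply, growth_zero hq, mul_zero, Real.rpow_zero, sub_self, sub_zero] at ht
  have ht'' : (0 : ℝ) < t := ht'
  rw [div_lt_iff₀ ht'', zero_mul] at ht
  linarith

end RieszProduct

/-! ### The `L ^ p` norms of the partial products -/

namespace RieszProduct

theorem one_add_mul_cosChar_nonneg {a : ℝ} (ha : a ∈ Set.Icc (-1 : ℝ) 1) (x : UnitAddCircle) :
    0 ≤ 1 + a * cosChar 1 x := by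
  simpa [density] using density_nonneg ha 1 1 x

theorem continuous_cosChar (m : ℤ) : Continuous (cosChar m) := by
  unfold cosChar
  fun_prop

theorem density_succ_eq (a : ℝ) (q n : ℕ) (x : UnitAddCircle) :
    density a q (n + 1) x = (1 + a * cosChar 1 x) * density a q n (q • x) := by
  simp only [density, Finset.prod_range_succ', pow_zero]
  rw [mul_comm]
  congr 1
  refine Finset.prod_congr rfl fun k _ => ?_
  simp only [cosChar, fourier_apply]
  rw [← natCast_zsmul, smul_smul, pow_succ]

theorem measurePreserving_nsmul_circle {q : ℕ} (hq : 2 ≤ q) :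
    MeasurePreserving (fun x : UnitAddCircle => q • x) volume volume :=
  (AddCircle.ergodic_nsmul (T := 1) (n := q) (by omega)).toMeasurePreserving

/-- The transfer operator estimate: translation by the `q`-torsion points leaves `x ↦ q x`
unchanged, so that the factor `(1 + a cos (2πx)) ^ (1 + t)` may be averaged over them. -/
theorem lintegral_rpow_mul_comp_nsmul_le {q : ℕ} (hq : 3 ≤ q) {a : ℝ}
    (ha : a ∈ Set.Icc (-1 : ℝ) 1) {t : ℝ} (ht : 0 < t) {H : UnitAddCircle → ℝ≥0∞}
    (hH : Measurable H) :
    ∫⁻ x : UnitAddCircle, ENNReal.ofReal ((1 + a * cosChar 1 x) ^ (1 + t)) * H (q • x)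
      ≤ ENNReal.ofReal (growth q t) * ∫⁻ x, H x := by
  have hq0 : (q : ℝ≥0∞) ≠ 0 := by simpa using (by omega : q ≠ 0)
  have hqr : (q : ℝ) ≠ 0 := by positivity
  set G : UnitAddCircle → ℝ≥0∞ := fun x => ENNReal.ofReal ((1 + a * cosChar 1 x) ^ (1 + t))
  have hG : Measurable G := by
    have := continuous_cosChar 1
    exact ((((this.const_mul a).const_add 1).rpow_const
      fun _ => Or.inr (by linarith))).measurable.ennreal_ofReal
  have hmp := measurePreserving_nsmul_circle (q := q) (by omega)
  have hHq : Measurable fun x : UnitAddCircle => H (q • x) := hH.comp hmp.measurable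
  let c : ℕ → UnitAddCircle := fun j => ((j / q : ℝ) : UnitAddCircle)
  have hc (j : ℕ) : q • c j = 0 := by
    have : q • c j = ((j : ℝ) : UnitAddCircle) := by
      simp only [c]
      rw [← AddCircle.coe_nsmul, nsmul_eq_mul, mul_div_cancel₀ _ hqr]
    rw [this, AddCircle.coe_eq_zero_iff]
    exact ⟨j, by simp⟩
  have hshift (j : ℕ) : ∫⁻ x, G x * H (q • x) = ∫⁻ x, G (x + c j) * H (q • x) := by
    rw [← lintegral_add_right_eq_self (fun x => G x * H (q • x)) (c j)]
    simp only [smul_add, hc, add_zero]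
  have hsum (x : UnitAddCircle) :
      ∑ j ∈ Finset.range q, G (x + c j) ≤ ENNReal.ofReal (q * growth q t) := by
    rw [← ENNReal.ofReal_sum_of_nonneg
      fun j _ => Real.rpow_nonneg (one_add_mul_cosChar_nonneg ha _) _]
    refine ENNReal.ofReal_le_ofReal ?_
    induction x using QuotientAddGroup.induction_on with
    | H x =>
      refine (Finset.sum_congr rfl fun j _ => ?_).trans_le
        (sum_rpow_rotation_le hq ha ht (2 * Real.pi * x))
      rw [← AddCircle.coe_add, cosChar_coe]
      congr 4
      push_cast
      ring
  refine (ENNReal.mul_le_mul_iff_right hq0 (ENNReal.natCast_ne_top q)).mp ?_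
  calc (q : ℝ≥0∞) * ∫⁻ x, G x * H (q • x)
      = ∑ j ∈ Finset.range q, ∫⁻ x, G (x + c j) * H (q • x) := by
        simp only [← hshift, Finset.sum_const, Finset.card_range, nsmul_eq_mul]
    _ = ∫⁻ x, (∑ j ∈ Finset.range q, G (x + c j)) * H (q • x) := by
        simp only [Finset.sum_mul]
        exact (lintegral_finsetSum _
          fun j _ => (hG.comp (measurable_add_const (c j))).mul hHq).symm
    _ ≤ ∫⁻ x : UnitAddCircle, ENNReal.ofReal (q * growth q t) * H (q • x) :=
        lintegral_mono fun x => mul_le_mul_left (hsum x) _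
    _ = _ := by
        rw [lintegral_const_mul _ hHq, hmp.lintegral_comp hH,
          ENNReal.ofReal_mul (by positivity), ENNReal.ofReal_natCast, mul_assoc]

theorem lintegral_density_rpow_le {q : ℕ} (hq : 3 ≤ q) {a : ℝ} (ha : a ∈ Set.Icc (-1 : ℝ) 1)
    {t : ℝ} (ht : 0 < t) (n : ℕ) :
    ∫⁻ x, ENNReal.ofReal (density a q n x) ^ (1 + t) ≤ ENNReal.ofReal (growth q t) ^ n := by
  induction n with
  | zero => simp [density]
  | succ n ih =>
    have hmeas : Measurable fun x => ENNReal.ofReal (density a q n x) ^ (1 + t) :=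
      (continuous_density a q n).measurable.ennreal_ofReal.pow_const _
    refine le_trans (le_of_eq (lintegral_congr fun x => ?_))
      ((lintegral_rpow_mul_comp_nsmul_le hq ha ht hmeas).trans ?_)
    · have h := one_add_mul_cosChar_nonneg ha x
      rw [density_succ_eq, ENNReal.ofReal_mul h, ENNReal.mul_rpow_of_nonneg _ _ (by linarith),
        ENNReal.ofReal_rpow_of_nonneg h (by linarith)]
    · rw [pow_succ']
      gcongr

/-! ### The Fejér kernel -/

/-- The Fejér kernel `|∑_{k < m} exp (2πikx)|²`, normalised to have integral `m`. -/
noncomputable def fejer (m : ℕ) (x : UnitAddCircle) : ℝ :=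
  ‖∑ k ∈ Finset.range m, fourier (k : ℤ) x‖ ^ 2

theorem fejer_nonneg (m : ℕ) (x : UnitAddCircle) : 0 ≤ fejer m x := by
  unfold fejer
  positivity

theorem continuous_fejer (m : ℕ) : Continuous (fejer m) := by
  unfold fejer
  fun_prop

theorem fejer_sub_eq (m : ℕ) (x y : UnitAddCircle) :
    (fejer m (x - y) : ℂ) = ∑ j ∈ Finset.range m, ∑ k ∈ Finset.range m,
      fourier ((j : ℤ) - k) x * fourier ((k : ℤ) - j) y := by
  rw [fejer, ← Complex.normSq_eq_norm_sq, Complex.normSq_eq_conj_mul_self, mul_comm, map_sum,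
    Finset.sum_mul_sum]
  refine Finset.sum_congr rfl fun j _ => Finset.sum_congr rfl fun k _ => ?_
  rw [← fourier_neg, ← fourier_add, ← sub_eq_add_neg]
  simp only [fourier_apply, AddCircle.toCircle_add, sub_eq_add_neg, smul_add, smul_neg,
    ← neg_smul, Circle.coe_mul]
  congr 4
  ring

/-- On the interval of length `1/(3m)` around `0`, all the characters of frequency less than `m`
have real part at least `1/2`. -/
theorem le_fejer {m : ℕ} {x : UnitAddCircle} (hx : 6 * m * ‖x‖ ≤ 1) :
    (m : ℝ) ^ 2 / 4 ≤ fejer m x := by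
  obtain ⟨y, rfl, hy⟩ : ∃ y : ℝ, (y : UnitAddCircle) = x ∧ |y| = ‖x‖ := by
    induction x using QuotientAddGroup.induction_on with
    | H x =>
      refine ⟨x - round x, ?_, UnitAddCircle.norm_eq.symm⟩
      rw [AddCircle.coe_sub, sub_eq_self, AddCircle.coe_eq_zero_iff]
      exact ⟨round x, by simp⟩
  rw [← hy] at hx
  have hpi := Real.pi_pos
  have h1 (k : ℕ) (hk : k ∈ Finset.range m) : 1 / 2 ≤ (fourier (k : ℤ) (y : UnitAddCircle)).re := by
    have hk' : (k : ℝ) ≤ m := by exact_mod_cast (Finset.mem_range.mp hk).le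
    change 1 / 2 ≤ cosChar k y
    rw [cosChar_coe, ← Real.cos_abs, ← Real.cos_pi_div_three]
    refine Real.cos_le_cos_of_nonneg_of_le_pi (abs_nonneg _) (by linarith) ?_
    have h2 : (k : ℝ) * |y| ≤ m * |y| := by gcongr
    rw [abs_mul, abs_of_nonneg (by positivity)]
    push_cast
    nlinarith
  have h2 : (m : ℝ) / 2 ≤ ‖∑ k ∈ Finset.range m, fourier (k : ℤ) (y : UnitAddCircle)‖ := by
    refine le_trans ?_ (Complex.re_le_norm _)
    rw [Complex.re_sum]
    refine le_trans (le_of_eq ?_) (Finset.sum_le_sum h1)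
    simp [div_eq_mul_inv]
  calc (m : ℝ) ^ 2 / 4 = (m / 2) ^ 2 := by ring
    _ ≤ _ := by unfold fejer; gcongr

theorem integrable_of_continuous {E : Type*} [NormedAddCommGroup E] {f : UnitAddCircle → E}
    (hf : Continuous f) (ν : Measure UnitAddCircle) [IsFiniteMeasure ν] : Integrable f ν :=
  hf.integrable_of_hasCompactSupport (HasCompactSupport.of_compactSpace _)

theorem integral_fourier_rieszProduct {a : ℝ} (ha : a ∈ Set.Icc (-1 : ℝ) 1) {q : ℕ} (hq : 3 ≤ q)
    {n : ℕ} {l : ℤ} (hl : 2 * |l| ≤ (q : ℤ) ^ n) :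
    ∫ x, (fourier l x : ℂ) ∂(rieszProduct a q : Measure UnitAddCircle) = coeff a q n l := by
  have h1 : Tendsto (fun N => coeff a q N l) atTop (𝓝 (coeff a q n l)) := by
    refine tendsto_const_nhds.congr' ?_
    filter_upwards [eventually_ge_atTop n] with N hN
    induction N, hN using Nat.le_induction with
    | base => rfl
    | succ N hN ih =>
      rw [coeff_stable a hq (hl.trans (pow_le_pow_right₀ (by omega) hN)), ih]
  have h2 := (FiniteMeasure.tendsto_iff_forall_integral_rclike_tendsto ℂ).mp
    (tendsto_partialMeasure ha hq) (BoundedContinuousFunction.mkOfCompact (fourier l))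
  simp only [BoundedContinuousFunction.mkOfCompact_apply, integral_partialMeasure ha] at h2
  exact tendsto_nhds_unique h2 h1

theorem integral_fejer_sub (ν : Measure UnitAddCircle) [IsFiniteMeasure ν] {f : UnitAddCircle → ℝ}
    (hf : Continuous f) (m : ℕ) (x : UnitAddCircle) :
    ((∫ y, fejer m (x - y) * f y ∂ν : ℝ) : ℂ) = ∑ j ∈ Finset.range m, ∑ k ∈ Finset.range m,
      fourier ((j : ℤ) - k) x * ∫ y, (fourier ((k : ℤ) - j) y : ℂ) * f y ∂ν := by
  rw [← integral_complex_ofReal]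
  simp only [Complex.ofReal_mul, fejer_sub_eq, Finset.sum_mul, mul_assoc]
  rw [integral_finsetSum _ fun j _ => integrable_of_continuous (by fun_prop) _]
  refine Finset.sum_congr rfl fun j _ => ?_
  rw [integral_finsetSum _ fun k _ => integrable_of_continuous (by fun_prop) _]
  refine Finset.sum_congr rfl fun k _ => ?_
  rw [integral_const_mul]

theorem two_mul_abs_sub_le {m j k : ℕ} {B : ℤ} (hm : 2 * (m : ℤ) ≤ B) (hj : j ∈ Finset.range m)
    (hk : k ∈ Finset.range m) : 2 * |(k : ℤ) - j| ≤ B := by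
  rw [Finset.mem_range] at hj hk
  rcases abs_cases ((k : ℤ) - j) with h | h <;> omega

/-- At the frequencies of a Fejér kernel of order at most `q ^ n / 2`, the Riesz product cannot be
told from its `n`-th partial product. -/
theorem lintegral_fejer_sub_rieszProduct {a : ℝ} (ha : a ∈ Set.Icc (-1 : ℝ) 1) {q : ℕ}
    (hq : 3 ≤ q) {m n : ℕ} (hm : 2 * m ≤ q ^ n) (x : UnitAddCircle) :
    ∫⁻ y, ENNReal.ofReal (fejer m (x - y)) ∂(rieszProduct a q : Measure UnitAddCircle)
      = ∫⁻ y, ENNReal.ofReal (fejer m (x - y)) * ENNReal.ofReal (density a q n y) := by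
  have hm' : 2 * (m : ℤ) ≤ (q : ℤ) ^ n := by exact_mod_cast hm
  have hF : Continuous fun y => fejer m (x - y) :=
    (continuous_fejer m).comp (continuous_const.sub continuous_id)
  have hd := continuous_density a q n
  simp only [← ENNReal.ofReal_mul (fejer_nonneg m _)]
  rw [← ofReal_integral_eq_lintegral_ofReal (integrable_of_continuous hF _)
      (ae_of_all _ fun y => fejer_nonneg m _),
    ← ofReal_integral_eq_lintegral_ofReal
      (f := fun y => fejer m (x - y) * density a q n y) (integrable_of_continuous (hF.mul hd) _)
      (ae_of_all _ fun y => mul_nonneg (fejer_nonneg m _) (density_nonneg ha q n y))]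
  congr 1
  have h1 := integral_fejer_sub (rieszProduct a q : Measure UnitAddCircle)
    (f := fun _ => 1) continuous_const m x
  have h2 := integral_fejer_sub volume hd m x
  simp only [mul_one, Complex.ofReal_one] at h1
  rw [← Complex.ofReal_inj, h1, h2]
  refine Finset.sum_congr rfl fun j hj => Finset.sum_congr rfl fun k hk => ?_
  rw [integral_fourier_rieszProduct ha hq (two_mul_abs_sub_le hm' hj hk), coeff]

theorem lintegral_fejer (m : ℕ) : ∫⁻ x, ENNReal.ofReal (fejer m x) = m := by
  have h := integral_fejer_sub volume (f := fun _ => 1) continuous_const m 0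
  have h0 (l : ℤ) : ∫ y : UnitAddCircle, (fourier l y : ℂ) = if l = 0 then 1 else 0 := by
    have e : coeff 0 1 0 l = ∫ y : UnitAddCircle, (fourier l y : ℂ) := by simp [coeff, density]
    split_ifs with hl
    · rw [← e, hl, coeff_zero_zero]
    · rw [← e, coeff_zero hl]
  simp only [mul_one, Complex.ofReal_one, h0, zero_sub, fourier_eval_zero, one_mul, sub_eq_zero,
    Nat.cast_inj, Finset.sum_ite_eq', Finset.sum_ite_mem, Finset.inter_self, Finset.sum_const,
    Finset.card_range, nsmul_eq_mul] at h
  have h1 : ∫ y, fejer m (0 - y) = ∫ y, fejer m y := integral_sub_left_eq_self _ _ 0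
  simp only [zero_sub] at h1
  rw [← ofReal_integral_eq_lintegral_ofReal (integrable_of_continuous (continuous_fejer m) _)
    (ae_of_all _ fun y => fejer_nonneg m _), ← h1,
    show ∫ y, fejer m (-y) = m by exact_mod_cast h, ENNReal.ofReal_natCast]

end RieszProduct

/-! ### Convolutions and balls -/

/-- Jensen's inequality for the weight `F` and the power `1 + t`. -/
theorem lintegral_mul_rpow_le {α : Type*} [MeasurableSpace α] {ν : Measure α} {F P : α → ℝ≥0∞}
    (hF : Measurable F) (hP : Measurable P) {t : ℝ} (ht : 0 < t) :
    (∫⁻ y, F y * P y ∂ν) ^ (1 + t) ≤ (∫⁻ y, F y ∂ν) ^ t * ∫⁻ y, F y * P y ^ (1 + t) ∂ν := by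
  have hp : (0 : ℝ) < 1 + t := by linarith
  have h := ENNReal.lintegral_mul_norm_pow_le (μ := ν) (p := t / (1 + t)) (q := 1 / (1 + t))
    hF.aemeasurable (hF.mul (hP.pow_const (1 + t))).aemeasurable (by positivity) (by positivity)
    (by field_simp; ring)
  have h1 : ∫⁻ y, F y * P y ∂ν
      = ∫⁻ y, F y ^ (t / (1 + t)) * (F y * P y ^ (1 + t)) ^ (1 / (1 + t)) ∂ν := by
    refine lintegral_congr fun y => ?_
    rw [ENNReal.mul_rpow_of_nonneg _ _ (by positivity), ← ENNReal.rpow_mul,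
      mul_one_div_cancel hp.ne', ENNReal.rpow_one, ← mul_assoc,
      ← ENNReal.rpow_add_of_nonneg _ _ (by positivity) (by positivity),
      show t / (1 + t) + 1 / (1 + t) = 1 by field_simp; ring, ENNReal.rpow_one]
  calc (∫⁻ y, F y * P y ∂ν) ^ (1 + t)
      ≤ ((∫⁻ y, F y ∂ν) ^ (t / (1 + t))
        * (∫⁻ y, F y * P y ^ (1 + t) ∂ν) ^ (1 / (1 + t))) ^ (1 + t) := by
        rw [h1]
        gcongr
        exact h
    _ = _ := by
        rw [ENNReal.mul_rpow_of_nonneg _ _ hp.le, ← ENNReal.rpow_mul, ← ENNReal.rpow_mul,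
          div_mul_cancel₀ _ hp.ne', div_mul_cancel₀ _ hp.ne', ENNReal.rpow_one]

/-- Young's inequality for the convolution of an integrable function with a function in
`L ^ (1 + t)`. -/
theorem lintegral_convolution_rpow_le {G : Type*} [AddCommGroup G] [MeasurableSpace G]
    [MeasurableAdd₂ G] [MeasurableNeg G] {ν : Measure G} [SFinite ν] [ν.IsAddLeftInvariant]
    [ν.IsNegInvariant] {F P : G → ℝ≥0∞} (hF : Measurable F) (hP : Measurable P) {t : ℝ}
    (ht : 0 < t) :
    ∫⁻ x, (∫⁻ y, F (x - y) * P y ∂ν) ^ (1 + t) ∂ν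
      ≤ (∫⁻ y, F y ∂ν) ^ (1 + t) * ∫⁻ y, P y ^ (1 + t) ∂ν := by
  have hsub : Measurable fun z : G × G => z.1 - z.2 := by
    simp only [sub_eq_add_neg]
    fun_prop
  have hmeas : Measurable (Function.uncurry fun x y : G => F (x - y) * P y ^ (1 + t)) :=
    (hF.comp hsub).mul ((hP.comp measurable_snd).pow_const _)
  have hFx (x : G) : Measurable fun y => F (x - y) :=
    hF.comp (hsub.comp (measurable_const.prodMk measurable_id))
  have hFy (y : G) : Measurable fun x => F (x - y) :=
    hF.comp (hsub.comp (measurable_id.prodMk measurable_const))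
  calc ∫⁻ x, (∫⁻ y, F (x - y) * P y ∂ν) ^ (1 + t) ∂ν
      ≤ ∫⁻ x, (∫⁻ y, F y ∂ν) ^ t * ∫⁻ y, F (x - y) * P y ^ (1 + t) ∂ν ∂ν := by
        refine lintegral_mono fun x => (lintegral_mul_rpow_le (hFx x) hP ht).trans_eq ?_
        rw [lintegral_sub_left_eq_self F x]
    _ = (∫⁻ y, F y ∂ν) ^ t * ∫⁻ y, ∫⁻ x, F (x - y) * P y ^ (1 + t) ∂ν ∂ν := by
        rw [lintegral_const_mul _ (by exact hmeas.lintegral_prod_right'),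
          lintegral_lintegral_swap hmeas.aemeasurable]
    _ = (∫⁻ y, F y ∂ν) ^ t * ∫⁻ y, (∫⁻ x, F x ∂ν) * P y ^ (1 + t) ∂ν := by
        congr 1
        refine lintegral_congr fun y => ?_
        rw [lintegral_mul_const _ (hFy y), lintegral_sub_right_eq_self F y]
    _ = _ := by
        rw [lintegral_const_mul _ (hP.pow_const _), ← mul_assoc, add_comm 1 t,
          ENNReal.rpow_add_of_nonneg _ _ ht.le zero_le_one, ENNReal.rpow_one]

theorem measurable_measure_closedBall {X : Type*} [PseudoMetricSpace X] [MeasurableSpace X]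
    [OpensMeasurableSpace X] [SecondCountableTopology X] (μ : Measure X) [SFinite μ] (r : ℝ) :
    Measurable fun x => μ (Metric.closedBall x r) := by
  have h : MeasurableSet {z : X × X | dist z.2 z.1 ≤ r} :=
    measurableSet_le (measurable_snd.dist measurable_fst) measurable_const
  exact measurable_measure_prodMk_left h

/-- The correlation integral of `μ` is controlled by the `L ^ (1 + t)` norm, with respect to a
reference measure `ν`, of the measures of balls of twice the radius. -/
theorem mul_lintegral_measure_closedBall_rpow_le {X : Type*} [PseudoMetricSpace X]
    [MeasurableSpace X] [OpensMeasurableSpace X] [SecondCountableTopology X] (μ ν : Measure X)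
    [SFinite μ] [SFinite ν] {r : ℝ} (hr : 0 ≤ r) {V : ℝ≥0∞}
    (hV : ∀ x, ν (Metric.closedBall x r) = V) {t : ℝ} (ht : 0 < t) :
    V * ∫⁻ x, μ (Metric.closedBall x r) ^ t ∂μ
      ≤ ∫⁻ y, μ (Metric.closedBall y (2 * r)) ^ (1 + t) ∂ν := by
  have h1 := measurable_measure_closedBall μ r
  have h2 := measurable_measure_closedBall μ (2 * r)
  let B : Set (X × X) := {z | dist z.1 z.2 ≤ r}
  have hB : MeasurableSet B :=
    measurableSet_le (measurable_fst.dist measurable_snd) measurable_const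
  have hmeas : Measurable (Function.uncurry fun x y : X =>
      (B.indicator (fun z => μ (Metric.closedBall z.2 (2 * r)) ^ t))
        (x, y)) :=
    ((h2.comp measurable_snd).pow_const t).indicator hB
  calc V * ∫⁻ x, μ (Metric.closedBall x r) ^ t ∂μ
      = ∫⁻ x, ∫⁻ y in Metric.closedBall x r, μ (Metric.closedBall x r) ^ t ∂ν ∂μ := by
        rw [← lintegral_const_mul _ (h1.pow_const t)]
        simp only [lintegral_const, Measure.restrict_apply_univ, hV, mul_comm]
    _ ≤ ∫⁻ x, ∫⁻ y in Metric.closedBall x r, μ (Metric.closedBall y (2 * r)) ^ t ∂ν ∂μ := by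
        refine lintegral_mono fun x => setLIntegral_mono (h2.pow_const t) fun y hy => ?_
        gcongr
        refine Metric.closedBall_subset_closedBall' ?_
        rw [dist_comm]
        linarith [Metric.mem_closedBall.mp hy]
    _ = ∫⁻ x, ∫⁻ y, (B.indicator
          (fun z => μ (Metric.closedBall z.2 (2 * r)) ^ t)) (x, y) ∂ν ∂μ := by
        refine lintegral_congr fun x => ?_
        rw [← lintegral_indicator Metric.isClosed_closedBall.measurableSet]
        refine lintegral_congr fun y => ?_
        by_cases hxy : dist x y ≤ r
        · rw [Set.indicator_of_mem (Metric.mem_closedBall'.mpr hxy), Set.indicator_of_mem (s := B) hxy]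
        · rw [Set.indicator_of_notMem (fun hy => hxy (Metric.mem_closedBall'.mp hy)),
            Set.indicator_of_notMem (s := B) hxy]
    _ = ∫⁻ y, ∫⁻ x, (B.indicator
          (fun z => μ (Metric.closedBall z.2 (2 * r)) ^ t)) (x, y) ∂μ ∂ν :=
        lintegral_lintegral_swap hmeas.aemeasurable
    _ = ∫⁻ y, μ (Metric.closedBall y (2 * r)) ^ t * μ (Metric.closedBall y r) ∂ν := by
        refine lintegral_congr fun y => ?_
        rw [← setLIntegral_const, ← lintegral_indicator Metric.isClosed_closedBall.measurableSet]
        refine lintegral_congr fun x => ?_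
        by_cases hxy : dist x y ≤ r
        · rw [Set.indicator_of_mem (Metric.mem_closedBall.mpr hxy), Set.indicator_of_mem (s := B) hxy]
        · rw [Set.indicator_of_notMem (fun hy => hxy (Metric.mem_closedBall.mp hy)),
            Set.indicator_of_notMem (s := B) hxy]
    _ ≤ _ := by
        refine lintegral_mono fun y => ?_
        rw [add_comm 1 t, ENNReal.rpow_add_of_nonneg _ _ ht.le zero_le_one, ENNReal.rpow_one]
        gcongr
        linarith

/-! ### The mass distribution principle -/

/-- The mass distribution principle, for balls whose radii form a geometric progression. -/
theorem le_dimH_of_measure_closedBall_le {X : Type*} [MetricSpace X] [MeasurableSpace X]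
    [BorelSpace X] (μ : Measure X) {A : Set X} (hA : MeasurableSet A) (hμA : μ A ≠ 0)
    {s : ℝ≥0} (hs : 0 < s) {ρ c : ℝ} (hρ0 : 0 < ρ) (hρ1 : ρ < 1) (hc : 0 < c) {N : ℕ}
    (h : ∀ x ∈ A, ∀ n ≥ N,
      μ (Metric.closedBall x (c * ρ ^ n)) ≤ ENNReal.ofReal ((ρ ^ n) ^ (s : ℝ))) :
    (s : ℝ≥0∞) ≤ dimH A := by
  have hs' : (0 : ℝ) < s := hs
  set K : ℝ≥0∞ := ENNReal.ofReal ((c * ρ) ^ (s : ℝ))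
  have hK : K ≠ 0 := by
    have : 0 < (c * ρ) ^ (s : ℝ) := by positivity
    simpa [K] using this
  have hle : K • μ.restrict A ≤ μH[(s : ℝ)] := by
    refine Measure.le_hausdorffMeasure _ _ (ENNReal.ofReal (c * ρ ^ N)) (by simp; positivity) ?_
    intro S hS
    rw [Measure.smul_apply, Measure.restrict_apply' hA, smul_eq_mul]
    rcases (S ∩ A).eq_empty_or_nonempty with hempty | ⟨x, hxS, hxA⟩
    · simp [hempty]
    have hfin : Metric.ediam S ≠ ∞ := ne_top_of_le_ne_top ENNReal.ofReal_ne_top hS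
    have hd : Metric.ediam S = ENNReal.ofReal (Metric.diam S) := (ENNReal.ofReal_toReal hfin).symm
    have hsub (R : ℝ) (hR : Metric.diam S ≤ R) : S ∩ A ⊆ Metric.closedBall x R := fun y hy =>
      (Metric.dist_le_diam_of_mem' hfin hy.1 hxS).trans hR
    have hdN : Metric.diam S ≤ c * ρ ^ N := ENNReal.toReal_le_of_le_ofReal (by positivity) hS
    rcases (Metric.diam_nonneg (s := S)).eq_or_lt with h0 | h0
    · -- A set of diameter zero lies in balls of arbitrarily small measure.
      have hz : μ (S ∩ A) = 0 := by
        have hlim : Tendsto (fun n : ℕ => ENNReal.ofReal ((ρ ^ n) ^ (s : ℝ))) atTop (𝓝 0) := by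
          have h1 := (tendsto_pow_atTop_nhds_zero_of_lt_one hρ0.le hρ1).rpow_const
            (p := (s : ℝ)) (Or.inr hs'.le)
          rw [Real.zero_rpow hs'.ne'] at h1
          simpa using ENNReal.tendsto_ofReal h1
        refine le_antisymm (ge_of_tendsto hlim ?_) zero_le
        filter_upwards [eventually_ge_atTop N] with n hn
        exact (measure_mono (hsub _ (by rw [← h0]; positivity))).trans (h x hxA n hn)
      simp [hz]
    · obtain ⟨n, hn1, hn2⟩ := exists_nat_pow_near_of_lt_one
        (x := Metric.diam S / (c * ρ ^ N)) (by positivity)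
        ((div_le_one (by positivity)).mpr hdN) hρ0 hρ1
      rw [lt_div_iff₀ (by positivity)] at hn1
      rw [div_le_iff₀ (by positivity)] at hn2
      have h1 : μ (S ∩ A) ≤ ENNReal.ofReal ((ρ ^ (N + n)) ^ (s : ℝ)) :=
        (measure_mono (hsub _ (hn2.trans_eq (by ring)))).trans (h x hxA (N + n) (by omega))
      rw [hd, ENNReal.ofReal_rpow_of_pos h0]
      refine (mul_le_mul_right h1 K).trans ?_
      rw [← ENNReal.ofReal_mul (by positivity), ← Real.mul_rpow (by positivity) (by positivity)]
      refine ENNReal.ofReal_le_ofReal (Real.rpow_le_rpow (by positivity) ?_ hs'.le)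
      calc c * ρ * ρ ^ (N + n) = ρ ^ (n + 1) * (c * ρ ^ N) := by ring
        _ ≤ _ := hn1.le
  refine le_dimH_of_hausdorffMeasure_ne_zero fun h0 => ?_
  have h1 := hle A
  rw [h0, Measure.smul_apply, Measure.restrict_apply_self, smul_eq_mul, nonpos_iff_eq_zero,
    mul_eq_zero] at h1
  exact h1.elim hK hμA

/-! ### The dimension of the Riesz product -/

namespace RieszProduct

/-- Since the Fejér kernel of order `m ≈ q ^ n / 2` is at least `m² / 4` on a ball of radius
comparable to `q ^ (-n)`, it majorizes the measure of such balls. -/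
theorem lintegral_measure_closedBall_rpow_le {q : ℕ} (hq : 3 ≤ q) {a : ℝ}
    (ha : a ∈ Set.Icc (-1 : ℝ) 1) {t : ℝ} (ht : 0 < t) {m n : ℕ} (hm : 2 * m ≤ q ^ n)
    {R : ℝ} (hR : 6 * m * R ≤ 1) :
    ENNReal.ofReal ((m : ℝ) ^ 2 / 4) ^ (1 + t) *
        ∫⁻ y, (rieszProduct a q : Measure UnitAddCircle) (Metric.closedBall y R) ^ (1 + t)
      ≤ (m : ℝ≥0∞) ^ (1 + t) * ENNReal.ofReal (growth q t) ^ n := by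
  set μ : Measure UnitAddCircle := (rieszProduct a q : Measure UnitAddCircle)
  have hF : Measurable fun x => ENNReal.ofReal (fejer m x) :=
    (continuous_fejer m).measurable.ennreal_ofReal
  have hP : Measurable fun x => ENNReal.ofReal (density a q n x) :=
    (continuous_density a q n).measurable.ennreal_ofReal
  have hball (y : UnitAddCircle) : ENNReal.ofReal ((m : ℝ) ^ 2 / 4) * μ (Metric.closedBall y R)
      ≤ ∫⁻ z, ENNReal.ofReal (fejer m (y - z)) * ENNReal.ofReal (density a q n z) := by
    rw [← lintegral_fejer_sub_rieszProduct ha hq hm, ← setLIntegral_const]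
    refine (setLIntegral_mono (hF.comp (measurable_const.sub measurable_id)) fun z hz => ?_).trans
      (setLIntegral_le_lintegral _ _)
    refine ENNReal.ofReal_le_ofReal (le_fejer ?_)
    change 6 * (m : ℝ) * ‖y - z‖ ≤ 1
    rw [← dist_eq_norm]
    refine le_trans ?_ hR
    gcongr
    exact Metric.mem_closedBall'.mp hz
  calc _ = ∫⁻ y, (ENNReal.ofReal ((m : ℝ) ^ 2 / 4) * μ (Metric.closedBall y R)) ^ (1 + t) := by
        rw [← lintegral_const_mul _ ((measurable_measure_closedBall μ R).pow_const _)]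
        simp only [ENNReal.mul_rpow_of_nonneg _ _ (show (0 : ℝ) ≤ 1 + t by linarith)]
    _ ≤ ∫⁻ y, (∫⁻ z, ENNReal.ofReal (fejer m (y - z)) * ENNReal.ofReal (density a q n z))
          ^ (1 + t) := by
        gcongr with y
        exact hball y
    _ ≤ _ := by
        refine (lintegral_convolution_rpow_le hF hP ht).trans ?_
        rw [lintegral_fejer]
        gcongr
        exact lintegral_density_rpow_le hq ha ht n

/-- The set of points at which the ball of radius `1 / (6 q ^ n)` has measure at least
`q ^ (- n s)`. -/
def heavySet (a : ℝ) (q : ℕ) (s : ℝ) (n : ℕ) : Set UnitAddCircle :=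
  {x | ENNReal.ofReal ((((q : ℝ)⁻¹) ^ n) ^ s)
    ≤ (rieszProduct a q : Measure UnitAddCircle) (Metric.closedBall x (1 / 6 * ((q : ℝ)⁻¹) ^ n))}

theorem measurableSet_heavySet (a : ℝ) (q : ℕ) (s : ℝ) (n : ℕ) :
    MeasurableSet (heavySet a q s n) :=
  measurableSet_le measurable_const (measurable_measure_closedBall _ _)

/-- Chebyshev's inequality for the correlation integrals. -/
theorem measure_heavySet_le {q : ℕ} (hq : 3 ≤ q) {a : ℝ} (ha : a ∈ Set.Icc (-1 : ℝ) 1)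
    {t : ℝ} (ht : 0 < t) (s : ℝ) {n : ℕ} (hn : 1 ≤ n) :
    (rieszProduct a q : Measure UnitAddCircle) (heavySet a q s n)
      ≤ ENNReal.ofReal (3 * 12 ^ (1 + t) * (growth q t / (q : ℝ) ^ ((1 - s) * t)) ^ n) := by
  set μ : Measure UnitAddCircle := (rieszProduct a q : Measure UnitAddCircle)
  set Q : ℝ := (q : ℝ) ^ n with hQ
  have hq0 : (0 : ℝ) < q := by positivity
  have hQ0 : 0 < Q := by positivity
  have hQ3 : 3 ≤ q ^ n := hq.trans (Nat.le_self_pow (by omega) q)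
  set m : ℕ := q ^ n / 2
  have hm : 2 * m ≤ q ^ n := Nat.mul_div_le _ _
  have hm3 : q ^ n ≤ 3 * m := by omega
  have hmQ : 2 * (m : ℝ) ≤ Q := by rw [hQ]; exact_mod_cast hm
  have hmQ3 : Q ≤ 3 * (m : ℝ) := by rw [hQ]; exact_mod_cast hm3
  have hm0 : (0 : ℝ) < m := by linarith
  have hp : (0 : ℝ) < 1 + t := by linarith
  have hg := growth_nonneg hq t
  set r : ℝ := 1 / 6 * ((q : ℝ)⁻¹) ^ n with hr
  have hrQ : r = 1 / (6 * Q) := by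
    rw [hr, hQ, inv_pow]
    field_simp
  have hr0 : 0 < r := by rw [hrQ]; positivity
  have hR : 6 * m * (2 * r) ≤ 1 := by
    rw [hrQ, show 6 * (m : ℝ) * (2 * (1 / (6 * Q))) = 2 * m / Q by field_simp]
    exact (div_le_one hQ0).mpr hmQ
  have hV (x : UnitAddCircle) : (volume : Measure UnitAddCircle) (Metric.closedBall x r)
      = ENNReal.ofReal (1 / (3 * Q)) := by
    have hQ1 : (3 : ℝ) ≤ Q := by rw [hQ]; exact_mod_cast hQ3
    have h2 : 2 * r = 1 / (3 * Q) := by rw [hrQ]; field_simp; norm_num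
    rw [AddCircle.volume_closedBall, h2, min_eq_right]
    rw [div_le_one (by positivity)]
    linarith
  set b : ℝ := (μ (heavySet a q s n)).toReal
  have hb : μ (heavySet a q s n) = ENNReal.ofReal b :=
    (ENNReal.ofReal_toReal (measure_ne_top _ _)).symm
  have hb0 : 0 ≤ b := ENNReal.toReal_nonneg
  have h1 : ENNReal.ofReal (((q : ℝ)⁻¹ ^ n) ^ s) ^ t * μ (heavySet a q s n)
      ≤ ∫⁻ x, μ (Metric.closedBall x r) ^ t ∂μ := by
    refine le_trans ?_ (mul_meas_ge_le_lintegral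
      ((measurable_measure_closedBall μ r).pow_const t)
      (ENNReal.ofReal (((q : ℝ)⁻¹ ^ n) ^ s) ^ t))
    gcongr
    intro x hx
    exact ENNReal.rpow_le_rpow hx ht.le
  have h2 := mul_lintegral_measure_closedBall_rpow_le μ volume hr0.le hV ht
  have h3 := lintegral_measure_closedBall_rpow_le hq ha ht hm hR
  have h4 : ENNReal.ofReal ((m : ℝ) ^ 2 / 4) ^ (1 + t) * (ENNReal.ofReal (1 / (3 * Q)) *
      (ENNReal.ofReal (((q : ℝ)⁻¹ ^ n) ^ s) ^ t * μ (heavySet a q s n)))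
      ≤ (m : ℝ≥0∞) ^ (1 + t) * ENNReal.ofReal (growth q t) ^ n := by
    refine le_trans ?_ h3
    gcongr
    refine le_trans ?_ h2
    gcongr
  rw [hb, ← ENNReal.ofReal_natCast m, ENNReal.ofReal_rpow_of_nonneg (by positivity) hp.le,
    ENNReal.ofReal_rpow_of_nonneg (by positivity) hp.le,
    ENNReal.ofReal_rpow_of_nonneg (by positivity) ht.le, ← ENNReal.ofReal_pow hg,
    ← ENNReal.ofReal_mul (by positivity), ← ENNReal.ofReal_mul (by positivity),
    ← ENNReal.ofReal_mul (by positivity), ← ENNReal.ofReal_mul (by positivity),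
    ENNReal.ofReal_le_ofReal_iff (by positivity)] at h4
  rw [hb]
  refine ENNReal.ofReal_le_ofReal ?_
  have e1 : ((m : ℝ) ^ 2 / 4) ^ (1 + t) = (m : ℝ) ^ (1 + t) * (m / 4 : ℝ) ^ (1 + t) := by
    rw [← Real.mul_rpow (by positivity) (by positivity)]
    congr 1
    ring
  have e2 : ((Q : ℝ) / 12) ^ (1 + t) ≤ (m / 4 : ℝ) ^ (1 + t) := by
    refine Real.rpow_le_rpow (by positivity) ?_ hp.le
    linarith
  -- Cancelling `m ^ (1 + t)` leaves `(m / 4) ^ (1 + t)`, and `m ≥ Q / 3`.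
  rw [e1, mul_assoc, mul_le_mul_iff_right₀ (by positivity)] at h4
  have h5 : (Q / 12) ^ (1 + t) * (1 / (3 * Q) * ((((q : ℝ)⁻¹ ^ n) ^ s) ^ t * b))
      ≤ growth q t ^ n := le_trans (by gcongr) h4
  have e3 : ((((q : ℝ)⁻¹ ^ n) ^ s) ^ t) = Q ^ (-(s * t)) := by
    rw [inv_pow, ← hQ, ← Real.rpow_mul (by positivity), Real.inv_rpow hQ0.le, Real.rpow_neg hQ0.le]
  have e4 : ((q : ℝ) ^ ((1 - s) * t)) ^ n = Q ^ ((1 - s) * t) := by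
    rw [hQ, ← Real.rpow_natCast, ← Real.rpow_natCast, ← Real.rpow_mul hq0.le,
      ← Real.rpow_mul hq0.le, mul_comm]
  have e5 : (Q / 12) ^ (1 + t) * (1 / (3 * Q) * (Q ^ (-(s * t)) * b))
      = Q ^ ((1 - s) * t) * b / (3 * 12 ^ (1 + t)) := by
    rw [Real.div_rpow hQ0.le (by norm_num), show (1 - s) * t = (1 + t) + (-1 + -(s * t)) by ring,
      Real.rpow_add hQ0 (1 + t) (-1 + -(s * t)), Real.rpow_add hQ0 (-1), Real.rpow_neg_one]
    field_simp
  rw [e3, e5, div_le_iff₀ (by positivity)] at h5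
  rw [div_pow, e4, mul_div_assoc', le_div_iff₀ (by positivity)]
  linarith

theorem ae_eventually_notMem_heavySet {q : ℕ} (hq : 3 ≤ q) {a : ℝ}
    (ha : a ∈ Set.Icc (-1 : ℝ) 1) {s t : ℝ} (ht : 0 < t)
    (hst : growth q t < (q : ℝ) ^ ((1 - s) * t)) :
    ∀ᵐ x ∂(rieszProduct a q : Measure UnitAddCircle), ∀ᶠ n in atTop, x ∉ heavySet a q s n := by
  have hg := growth_nonneg hq t
  have hq0 : (0 : ℝ) < q := by positivity
  have hθ : growth q t / (q : ℝ) ^ ((1 - s) * t) < 1 := (div_lt_one (by positivity)).mpr hst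
  have hsum : Summable fun n : ℕ =>
      3 * 12 ^ (1 + t) * (growth q t / (q : ℝ) ^ ((1 - s) * t)) ^ (n + 1) :=
    (((summable_nat_add_iff 1).mpr
      (summable_geometric_of_lt_one (by positivity) hθ)).mul_left _)
  have h : ∀ᵐ x ∂(rieszProduct a q : Measure UnitAddCircle),
      ∀ᶠ n in atTop, x ∉ heavySet a q s (n + 1) := by
    refine ae_eventually_notMem (ne_top_of_le_ne_top ?_
      (ENNReal.tsum_le_tsum fun n => measure_heavySet_le hq ha ht s (Nat.le_add_left 1 n)))
    rw [← ENNReal.ofReal_tsum_of_nonneg (fun n => by positivity) hsum]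
    exact ENNReal.ofReal_ne_top
  filter_upwards [h] with x hx
  obtain ⟨N, hN⟩ := eventually_atTop.mp hx
  filter_upwards [eventually_ge_atTop (N + 1)] with n hn
  obtain ⟨k, rfl⟩ := Nat.exists_eq_add_of_le' (show 1 ≤ n by omega)
  exact hN k (by omega)

/-- A set of positive measure has dimension at least `s`, provided that the power means of the
vertex weights grow slowly enough for some exponent. -/
theorem le_dimH_of_growth_lt {q : ℕ} (hq : 3 ≤ q) {a : ℝ} (ha : a ∈ Set.Icc (-1 : ℝ) 1)
    {s : ℝ≥0} (hs : 0 < s) {t : ℝ} (ht : 0 < t)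
    (hst : growth q t < (q : ℝ) ^ ((1 - s) * t)) {F : Set UnitAddCircle} (hF : MeasurableSet F)
    (hμF : (rieszProduct a q : Measure UnitAddCircle) F ≠ 0) : (s : ℝ≥0∞) ≤ dimH F := by
  set μ : Measure UnitAddCircle := (rieszProduct a q : Measure UnitAddCircle)
  let A : ℕ → Set UnitAddCircle := fun N => F ∩ ⋂ n ≥ N, (heavySet a q s n)ᶜ
  have hA (N : ℕ) : MeasurableSet (A N) :=
    hF.inter (MeasurableSet.biInter (Set.to_countable _)
      fun n _ => (measurableSet_heavySet a q s n).compl)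
  obtain ⟨N, hN⟩ : ∃ N, μ (A N) ≠ 0 := by
    by_contra! hcon
    refine hμF (measure_mono_null_ae ?_ (measure_iUnion_null hcon))
    filter_upwards [ae_eventually_notMem_heavySet hq ha ht hst] with x hx hxF
    obtain ⟨N, hN⟩ := eventually_atTop.mp hx
    exact Set.mem_iUnion.mpr ⟨N, hxF, Set.mem_iInter₂.mpr hN⟩
  have hq1 : (1 : ℝ) < q := by exact_mod_cast (by omega : 1 < q)
  refine le_trans ?_ (dimH_mono (Set.inter_subset_left : A N ⊆ F))
  refine le_dimH_of_measure_closedBall_le μ (hA N) hN hs (ρ := (q : ℝ)⁻¹) (c := 1 / 6) (N := N)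
    (by positivity) (inv_lt_one_of_one_lt₀ hq1) (by norm_num) fun x hx n hn => ?_
  have hx' : x ∉ heavySet a q s n := Set.mem_iInter₂.mp hx.2 n hn
  exact (not_le.mp hx').le

end RieszProduct

theorem theorem1p2 (q : ℕ) (hq : 3 ≤ q) (a : ℝ) (ha : a ∈ Set.Icc (-1 : ℝ) 1) :
    ((1 - 1 / (q * Real.log q) * ∑ j ∈ Finset.Icc 1 (q - 2),
        (1 - Real.cos ((2 * j + 1) * Real.pi / q) / Real.cos (Real.pi / q)) *
          Real.log (1 - Real.cos ((2 * j + 1) * Real.pi / q) / Real.cos (Real.pi / q)) : ℝ) :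
      EReal) ≤ (lowerHausdorffDim (rieszProduct a q : Measure UnitAddCircle) : EReal) := by
  set D : ℝ := 1 - 1 / (q * Real.log q) * ∑ j ∈ Finset.Icc 1 (q - 2),
    (1 - Real.cos ((2 * j + 1) * Real.pi / q) / Real.cos (Real.pi / q)) *
      Real.log (1 - Real.cos ((2 * j + 1) * Real.pi / q) / Real.cos (Real.pi / q)) with hD
  have h : ENNReal.ofReal D ≤ lowerHausdorffDim (rieszProduct a q : Measure UnitAddCircle) := by
    refine le_sInf ?_
    rintro α ⟨F, hF, hμF, hα⟩
    refine le_trans (le_of_forall_lt fun s hs => ?_) hα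
    obtain ⟨u, hsu, hu⟩ := ENNReal.lt_iff_exists_nnreal_btwn.mp hs
    have hu0 : 0 < u := by
      have := (zero_le (a := s)).trans_lt hsu
      exact_mod_cast this
    have huD : (u : ℝ) < D := by
      rw [← ENNReal.ofReal_coe_nnreal] at hu
      exact (ENNReal.ofReal_lt_ofReal_iff_of_nonneg u.coe_nonneg).mp hu
    obtain ⟨t, ht, hut⟩ := RieszProduct.exists_growth_lt hq huD
    exact hsu.trans_le (RieszProduct.le_dimH_of_growth_lt hq ha hu0 ht hut hF hμF)
  calc (D : EReal) ≤ (ENNReal.ofReal D : EReal) := by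
        rw [EReal.coe_ennreal_ofReal]
        exact_mod_cast le_max_left D 0
    _ ≤ _ := by exact_mod_cast h
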